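/- Logarithms are to base $2$, and $H$ is the Shannon entropy of a probability distribution on a finite or countable set, $H(q)=\sum_a q(a)\log\frac1{q(a)}\in[0,\infty]$ with $0\log\frac10=0$; $H(Z)$ is the entropy of the distribution of $Z$. Let $\mathcal P_n$ be the set of probability vectors $(p_1,\dots,p_n)$ with $p_1\ge\dots\ge p_n\ge 0$, partially ordered by majorization: $\mathbf a\preceq\mathbf b$ if and only if $\sum_{l\le j}a_l\le\sum_{l\le j}b_l$ for all $j=1,\dots,n$. Any two elements $\mathbf a,\mathbf b$ of $\mathcal P_n$ have a greatest lower bound, denoted $\mathbf a\wedge\mathbf b$. Let $k,n\ge 1$, let $X$ and $Y$ be random variables on a probability space such that $X$ takes (almost surely) the distinct values $x_1,\dots,x_k$, each with positive probability, and $Y$ takes values in a set of $n$ elements. For $i=1,\dots,k$ let $\mathbf p^{(i)}\in\mathcal P_n$ be the conditional distribution of $Y$ given $X=x_i$, with its components arranged in non-increasing order. (i) Let $X'$ and $Z$ be random variables on a common probability space, $Z$ with values in a finite or countable set, such that $Z$ is independent of $X'$ and, for some function $f$, the pair $(X',f(X',Z))$ has the same joint distribution as $(X,Y)$ (so $X'$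 has the distribution of $X$; in particular $X'=X$ is allowed). Then $$H(Z)\ \ge\ H(\mathbf p^{(1)}\wedge\mathbf p^{(2)}\wedge\dots\wedge\mathbf p^{(k)}).$$ (ii) Conversely, on some extension of the probability space of $X$ and $Y$ there are a random variable $Z$ with values in a countable set, independent of $X$, and a function $f$ such that $(X,f(X,Z))$ has the same joint distribution as $(X,Y)$ and $$H(Z)\ \le\ H(\mathbf p^{(1)}\wedge\mathbf p^{(2)}\wedge\dots\wedge\mathbf p^{(k)})+\log k.$$ -/

import Mathlib

open MeasureTheory ProbabilityTheory
open scoped ENNReal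

universe u

noncomputable section

/-- The simplex `𝒫 n` of all probability vectors with `n` components in non-increasing order. -/
@[ext]
structure OrderedProbVec (n : ℕ) where
  val : Fin n → ℝ
  antitone : Antitone val
  nonneg : ∀ i, 0 ≤ val i
  sum_eq_one : ∑ i, val i = 1

namespace OrderedProbVec

variable {n : ℕ}

/-- The sum of the first (that is, of the largest) `j` components. -/
def psum (a : OrderedProbVec n) (j : ℕ) : ℝ :=
  ∑ i : Fin n with i.val < j, a.val i

theorem psum_zero (a : OrderedProbVec n) : a.psum 0 = 0 := by simp [psum]

theorem psum_of_le (a : OrderedProbVec n) {j : ℕ} (hj : n ≤ j) : a.psum j = 1 := by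
  have : (Finset.univ.filter fun i : Fin n => i.val < j) = Finset.univ := by
    ext i
    simpa using i.isLt.trans_le hj
  rw [psum, this, a.sum_eq_one]

theorem psum_succ (a : OrderedProbVec n) {j : ℕ} (hj : j < n) :
    a.psum (j + 1) = a.psum j + a.val ⟨j, hj⟩ := by
  have : (Finset.univ.filter fun i : Fin n => i.val < j + 1)
      = insert ⟨j, hj⟩ (Finset.univ.filter fun i : Fin n => i.val < j) := by
    ext i
    simp [Fin.ext_iff]
    omega
  rw [psum, this, Finset.sum_insert (by simp), psum, add_comm]

theorem psum_mono (a : OrderedProbVec n) (j : ℕ) : a.psum j ≤ a.psum (j + 1) := by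
  by_cases hj : j < n
  · rw [a.psum_succ hj]
    linarith [a.nonneg ⟨j, hj⟩]
  · rw [a.psum_of_le (by omega), a.psum_of_le (by omega)]

theorem psum_concave (a : OrderedProbVec n) (j : ℕ) :
    a.psum (j + 2) + a.psum j ≤ 2 * a.psum (j + 1) := by
  by_cases hj : j + 1 < n
  · have h1 := a.psum_succ hj
    have h2 := a.psum_succ (show j < n by omega)
    have h3 := a.antitone (show (⟨j, by omega⟩ : Fin n) ≤ ⟨j + 1, hj⟩ by simp)
    rw [show j + 2 = j + 1 + 1 by rfl]
    linarith
  · have h1 := a.psum_of_le (show n ≤ j + 1 by omega)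
    have h2 := a.psum_of_le (show n ≤ j + 2 by omega)
    have h3 := a.psum_mono j
    linarith

theorem ext_psum {a b : OrderedProbVec n} (h : ∀ j, a.psum j = b.psum j) : a = b := by
  ext i
  have h1 := a.psum_succ i.isLt
  have h2 := b.psum_succ i.isLt
  rw [h, h, h2] at h1
  simpa using h1.symm

/-- Majorization: `a ≤ b` means that `a` is majorized by `b`. -/
instance : PartialOrder (OrderedProbVec n) where
  le a b := ∀ j, a.psum j ≤ b.psum j
  le_refl _ _ := le_rfl
  le_trans _ _ _ hab hbc j := (hab j).trans (hbc j)
  le_antisymm _ _ hab hba := ext_psum fun j => le_antisymm (hab j) (hba j)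

theorem le_iff {a b : OrderedProbVec n} : a ≤ b ↔ ∀ j, a.psum j ≤ b.psum j := Iff.rfl

/-- The ordered probability vector whose partial sums are the minima of those of `a` and `b`. -/
def meet (a b : OrderedProbVec n) : OrderedProbVec n where
  val i := min (a.psum (i + 1)) (b.psum (i + 1)) - min (a.psum i) (b.psum i)
  antitone := by
    have key : Antitone fun j : ℕ =>
        min (a.psum (j + 1)) (b.psum (j + 1)) - min (a.psum j) (b.psum j) := by
      refine antitone_nat_of_succ_le fun j => ?_
      have ha := a.psum_concave j
      have hb := b.psum_concave j
      have h1 := min_le_left (a.psum j) (b.psum j)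
      have h2 := min_le_right (a.psum j) (b.psum j)
      have h3 := min_le_left (a.psum (j + 2)) (b.psum (j + 2))
      have h4 := min_le_right (a.psum (j + 2)) (b.psum (j + 2))
      change min (a.psum (j + 2)) (b.psum (j + 2)) - _ ≤ _
      rcases min_choice (a.psum (j + 1)) (b.psum (j + 1)) with h | h <;> rw [h] <;> linarith
    exact fun i j hij => key hij
  nonneg i := sub_nonneg.2 (min_le_min (a.psum_mono i) (b.psum_mono i))
  sum_eq_one := by
    rw [Fin.sum_univ_eq_sum_range
      (fun j => min (a.psum (j + 1)) (b.psum (j + 1)) - min (a.psum j) (b.psum j)) n,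
      Finset.sum_range_sub (fun j => min (a.psum j) (b.psum j)), a.psum_of_le le_rfl,
      b.psum_of_le le_rfl, a.psum_zero, b.psum_zero]
    simp

theorem psum_meet (a b : OrderedProbVec n) (j : ℕ) :
    (meet a b).psum j = min (a.psum j) (b.psum j) := by
  induction j with
  | zero => simp [psum_zero]
  | succ j ih =>
    by_cases hj : j < n
    · rw [psum_succ _ hj, ih]
      simp [meet]
    · rw [psum_of_le _ (by omega), psum_of_le _ (by omega), psum_of_le _ (by omega), min_self]

/-- The infimum `a ⊓ b` is the greatest lower bound `a ∧ b` for majorization. -/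
instance : SemilatticeInf (OrderedProbVec n) where
  inf := meet
  inf_le_left a b j := by rw [psum_meet]; exact min_le_left _ _
  inf_le_right a b j := by rw [psum_meet]; exact min_le_right _ _
  le_inf a b c hab hac j := by rw [psum_meet]; exact le_min (hab j) (hac j)

/-- The components of a probability distribution on a finite set, in non-increasing order. -/
def ofDist {α : Type*} [Fintype α] (p : stdSimplex ℝ α) :
    OrderedProbVec (Fintype.card α) where
  val i := p.1 ((Fintype.equivFin α).symm
    (Tuple.sort (fun j => -p.1 ((Fintype.equivFin α).symm j)) i))
  antitone i j hij := neg_le_neg_iff.1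
    (Tuple.monotone_sort (fun j => -p.1 ((Fintype.equivFin α).symm j)) hij)
  nonneg i := p.2.1 _
  sum_eq_one := by
    rw [← p.2.2]
    exact Fintype.sum_equiv ((Tuple.sort _).trans (Fintype.equivFin α).symm) _ _ fun _ => rfl

end OrderedProbVec

/-- Shannon entropy in bits, `∑ p(a) log₂ (1 / p(a))`, of a probability mass function on a finite
or countable set; the terms are nonnegative and the sum may be infinite. A term with `p a = 0`
vanishes. -/
def shannonEntropy {α : Type*} (p : α → ℝ) : ℝ≥0∞ :=
  ∑' a, ENNReal.ofReal (p a * Real.logb 2 (1 / p a))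

section RandomVariables

variable {Ω 𝒳 𝒴 : Type*} [MeasurableSpace Ω] [MeasurableSpace 𝒳] [MeasurableSpace 𝒴]

/-- The probability mass function of a random variable. -/
def massFn (P : Measure Ω) (Y : Ω → 𝒴) (y : 𝒴) : ℝ := P.real (Y ⁻¹' {y})

/-- The conditional distribution of `Y` given `X = x`, for an event `X = x` of positive
probability and a random variable `Y` with finitely many values. -/
def condDist [Fintype 𝒴] [MeasurableSingletonClass 𝒴]
    (P : Measure Ω) [IsProbabilityMeasure P] (X : Ω → 𝒳)
    {Y : Ω → 𝒴} (hY : Measurable Y) (x : 𝒳) (hx : P (X ⁻¹' {x}) ≠ 0) : stdSimplex ℝ 𝒴 :=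
  ⟨fun y => massFn P[|X ⁻¹' {x}] Y y, fun _ => measureReal_nonneg, by
    have := cond_isProbabilityMeasure hx
    have h := sum_measureReal_preimage_singleton (μ := P[|X ⁻¹' {x}]) (f := Y) Finset.univ
      (fun y _ => hY (measurableSet_singleton y))
    simpa [massFn] using h⟩

/-- `(X', Z, f)`, on a probability space `(Ω', P')`, represents the joint distribution of
`(X, Y)`: `Z` is independent of `X'`, and `(X', f(X', Z))` has the distribution of `(X, Y)`
(so that in particular `X'` has the distribution of `X`). -/
structure IsFunctionalRepresentation {Ω' 𝒵 : Type*} [MeasurableSpace Ω'] [MeasurableSpace 𝒵]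
    (P : Measure Ω) (X : Ω → 𝒳) (Y : Ω → 𝒴)
    (P' : Measure Ω') (X' : Ω' → 𝒳) (Z : Ω' → 𝒵) (f : 𝒳 → 𝒵 → 𝒴) : Prop where
  measurable_left : Measurable X'
  measurable_right : Measurable Z
  indep : IndepFun X' Z P'
  identDistrib : IdentDistrib (fun ω => (X ω, Y ω)) (fun ω => (X' ω, f (X' ω) (Z ω))) P P'

end RandomVariables

end

/-!
Write `q` for the meet of the ordered conditional distributions `p i`. Its partial sums are the
minima of those of the `p i`, so each partial sum of `q` is attained by some `p i`.

*Lower bound.* By independence `f (x i) Z` has the conditional distribution of `Y` given `x i`, so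
all of these are images of the finitely valued variable `W = (f (x i) Z)ᵢ`, a function of `Z`; hence
`H(W) ≤ H(Z)`. A distribution is majorized by its images, so the sorted law of `W` is majorized by
every `p i`, and therefore by `q`. Schur concavity of entropy (`OrderedProbVec.sum_negMulLog_le`:
the tangent inequality for `negMulLog`, and summation by parts) gives `H(q) ≤ H(W)`.

*Upper bound.* If `q` is majorized by `p`, then `p` is obtained from `q` by cutting every `q l` into
at most two parts, one of which goes to the component `l` of `p` and the other, whole, to some other
component (`OrderedProbVec.exists_two_part_splitting`). The components are treated from the
smallest to the largest. The component `j` of `p` is filled with waiting parts of later components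
of `q` and with a part of `q j`; as the waiting parts are at most `q j`, only `q j` has to be cut.
The waiting mass equals the difference of the partial sums of `p` and `q` at `j`. Hence `q j` is
left whole for those `p i` that attain the partial sum of `q` at `j`, and the `k` cuts of `q j` give
only `k` pieces (`OrderedProbVec.exists_common_refinement`). Take for `Z` a variable, independent of
`X`, that has the masses of the pieces: `k` pieces of `q j` contribute at most `log k` times `q j`
more than `q j` itself, and every `p i` is an image of the law of `Z`.
-/

/-! ### Partial sums and majorization -/

namespace OrderedProbVec

variable {n : ℕ}

theorem psum_inf (a b : OrderedProbVec n) (j : ℕ) :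
    (a ⊓ b).psum j = min (a.psum j) (b.psum j) :=
  psum_meet a b j

theorem exists_psum_inf'_eq {ι : Type*} {s : Finset ι} (hs : s.Nonempty)
    (p : ι → OrderedProbVec n) (j : ℕ) : ∃ i ∈ s, (s.inf' hs p).psum j = (p i).psum j := by
  have h := Finset.apply_inf'_eq_inf'_comp hs (f := p) (fun a : OrderedProbVec n => a.psum j)
    (fun a b => psum_inf a b j)
  obtain ⟨i, hi, hi'⟩ := Finset.exists_mem_eq_inf' hs ((fun a : OrderedProbVec n => a.psum j) ∘ p)
  exact ⟨i, hi, h.trans hi'⟩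

theorem psum_eq_sum_range (a : OrderedProbVec n) (j : ℕ) :
    a.psum j = ∑ l ∈ Finset.range j, (a.psum (l + 1) - a.psum l) := by
  rw [Finset.sum_range_sub, psum_zero, sub_zero]

theorem sum_comp_val (a : OrderedProbVec n) {F : ℝ → ℝ} (hF : F 0 = 0) {m : ℕ} (hm : n ≤ m) :
    ∑ i, F (a.val i) = ∑ l ∈ Finset.range m, F (a.psum (l + 1) - a.psum l) := by
  have h1 : ∀ i : Fin n, F (a.val i) = F (a.psum (i + 1) - a.psum i) := fun i => by
    rw [a.psum_succ i.isLt, add_sub_cancel_left]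
  rw [Finset.sum_congr rfl fun i _ => h1 i,
    Fin.sum_univ_eq_sum_range (fun l => F (a.psum (l + 1) - a.psum l)) n]
  refine Finset.sum_subset (Finset.range_subset_range.2 hm) fun l _ hl => ?_
  have hl : n ≤ l := by simpa using hl
  rw [a.psum_of_le hl, a.psum_of_le (by omega), sub_self, hF]

theorem sum_le_psum (a : OrderedProbVec n) {s : Finset (Fin n)} {j : ℕ} (hs : s.card ≤ j) :
    ∑ i ∈ s, a.val i ≤ a.psum j := by
  by_cases hj : j < n
  · set t : Finset (Fin n) := Finset.univ.filter fun i => i.val < j with ht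
    have htc : t.card = j := by
      rw [ht, Fin.card_filter_val_lt, min_eq_right hj.le]
    have h1 : ∑ i ∈ s \ t, a.val i ≤ (s \ t).card • a.val ⟨j, hj⟩ :=
      Finset.sum_le_card_nsmul _ _ _ fun i hi => a.antitone (by
        simp [ht] at hi
        exact hi.2)
    have h2 : (t \ s).card • a.val ⟨j, hj⟩ ≤ ∑ i ∈ t \ s, a.val i :=
      Finset.card_nsmul_le_sum _ _ _ fun i hi => a.antitone (by
        simp [ht] at hi
        exact hi.1.le)
    have h3 : (s \ t).card • a.val ⟨j, hj⟩ ≤ (t \ s).card • a.val ⟨j, hj⟩ :=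
      nsmul_le_nsmul_left (a.nonneg _) (Finset.card_sdiff_le_card_sdiff_iff.2 (htc ▸ hs))
    have h4 := Finset.sum_inter_add_sum_sdiff s t a.val
    have h5 := Finset.sum_inter_add_sum_sdiff t s a.val
    rw [Finset.inter_comm] at h5
    change _ ≤ ∑ i ∈ t, a.val i
    linarith
  · rw [a.psum_of_le (by omega), ← a.sum_eq_one]
    exact Finset.sum_le_univ_sum_of_nonneg a.nonneg

variable {α : Type*} [Fintype α]

/-- The enumeration of a finite set by which `ofDist p` lists the components of `p`. -/
noncomputable def sortEquiv (p : stdSimplex ℝ α) : Fin (Fintype.card α) ≃ α :=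
  (Tuple.sort fun j => -p.1 ((Fintype.equivFin α).symm j)).trans (Fintype.equivFin α).symm

theorem ofDist_val (p : stdSimplex ℝ α) (i : Fin (Fintype.card α)) :
    (ofDist p).val i = p.1 (sortEquiv p i) := rfl

theorem sum_le_psum_ofDist (p : stdSimplex ℝ α) {s : Finset α} {j : ℕ} (hs : s.card ≤ j) :
    ∑ y ∈ s, p.1 y ≤ (ofDist p).psum j := by
  refine le_of_eq_of_le ?_ (sum_le_psum (ofDist p) (s := s.map (sortEquiv p).symm.toEmbedding)
    (by simpa using hs))
  simp [ofDist_val]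

theorem exists_psum_ofDist_eq (p : stdSimplex ℝ α) (j : ℕ) :
    ∃ s : Finset α, s.card ≤ j ∧ (ofDist p).psum j = ∑ y ∈ s, p.1 y := by
  refine ⟨(Finset.univ.filter fun i : Fin (Fintype.card α) => i.val < j).map
    (sortEquiv p).toEmbedding, ?_, ?_⟩
  · rw [Finset.card_map, Fin.card_filter_val_lt]
    exact min_le_right _ _
  · rw [Finset.sum_map]
    rfl

/-- A distribution on a finite set is majorized by each of its images. -/
theorem psum_ofDist_le_of_map {β : Type*} [Fintype β] [DecidableEq β] (p : stdSimplex ℝ α)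
    (r : stdSimplex ℝ β) (h : α → β) (hr : ∀ y, r.1 y = ∑ a with h a = y, p.1 a) (j : ℕ) :
    (ofDist p).psum j ≤ (ofDist r).psum j := by
  obtain ⟨s, hs, hs'⟩ := exists_psum_ofDist_eq p j
  rw [hs']
  refine le_trans ?_ (sum_le_psum_ofDist r (s := s.image h) (Finset.card_image_le.trans hs))
  rw [Finset.sum_congr rfl fun y _ => hr y,
    ← Finset.sum_fiberwise_of_maps_to (g := h) (t := s.image h)
      (fun a ha => Finset.mem_image_of_mem h ha)]
  refine Finset.sum_le_sum fun y _ => Finset.sum_le_sum_of_subset_of_nonneg ?_ fun a _ _ => p.2.1 a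
  intro a
  simp

end OrderedProbVec

/-! ### Schur concavity of entropy -/

/-- Summation by parts: a nondecreasing weight `c`, bounded by `C`, against differences whose
partial sums are nonnegative. -/
theorem sum_mul_le_of_partialSums_nonneg (c d : ℕ → ℝ) (m : ℕ)
    (hd : ∀ j ≤ m, 0 ≤ ∑ l ∈ Finset.range j, d l) (C : ℝ)
    (hc : ∀ l < m, ∀ l' ≤ l, c l' ≤ c l) (hC : ∀ l < m, c l ≤ C) :
    ∑ l ∈ Finset.range m, c l * d l ≤ C * ∑ l ∈ Finset.range m, d l := by
  induction m generalizing C with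
  | zero => simp
  | succ m ih =>
    rw [Finset.sum_range_succ, Finset.sum_range_succ]
    have h1 := ih (fun j hj => hd j (by omega)) (c m) (fun l hl => hc l (by omega))
      (fun l hl => hc m (by omega) l hl.le)
    have h2 := hd (m + 1) le_rfl
    rw [Finset.sum_range_succ] at h2
    nlinarith [hC m (by omega), mul_nonneg (sub_nonneg.2 (hC m (by omega))) h2]

/-- The tangent of the concave function `negMulLog` at `x` lies above its graph. -/
theorem negMulLog_le_tangent {x y : ℝ} (hx : 0 < x) (hy : 0 ≤ y) :
    Real.negMulLog y ≤ Real.negMulLog x + (-Real.log x - 1) * (y - x) := by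
  rcases hy.eq_or_lt with rfl | hy
  · simp [Real.negMulLog]
    nlinarith
  · have h := Real.log_le_sub_one_of_pos (div_pos hx hy)
    rw [Real.log_div hx.ne' hy.ne'] at h
    have h2 := mul_le_mul_of_nonneg_left h hy.le
    have h3 : y * (x / y - 1) = x - y := by field_simp
    rw [h3] at h2
    simp only [Real.negMulLog]
    linarith

/-- Schur concavity of entropy, for vectors of possibly different lengths. -/
theorem OrderedProbVec.sum_negMulLog_le {n m : ℕ} (a : OrderedProbVec m) (b : OrderedProbVec n)
    (h : ∀ j, a.psum j ≤ b.psum j) :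
    ∑ i, Real.negMulLog (b.val i) ≤ ∑ i, Real.negMulLog (a.val i) := by
  set A : ℕ → ℝ := fun l => a.psum (l + 1) - a.psum l with hA
  set B : ℕ → ℝ := fun l => b.psum (l + 1) - b.psum l with hB
  have hA_anti : Antitone A := antitone_nat_of_succ_le fun l => by
    have := a.psum_concave l
    simp only [hA]
    rw [show l + 1 + 1 = l + 2 by rfl]
    linarith
  have hA_nonneg : ∀ l, 0 ≤ A l := fun l => sub_nonneg.2 (a.psum_mono l)
  have hB_nonneg : ∀ l, 0 ≤ B l := fun l => sub_nonneg.2 (b.psum_mono l)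
  have hAm : A m = 0 := by simp [hA, a.psum_of_le]
  -- `N` is the number of positive components of `a`.
  have hex : ∃ l, A l = 0 := ⟨m, hAm⟩
  classical
  set N := Nat.find hex with hN
  have hA_pos : ∀ l < N, 0 < A l := fun l hl =>
    lt_of_le_of_ne (hA_nonneg l) fun h0 => Nat.find_min hex hl h0.symm
  have hA_zero : ∀ l, N ≤ l → A l = 0 := fun l hl =>
    le_antisymm ((hA_anti hl).trans (Nat.find_spec hex).le) (hA_nonneg l)
  have hsumA : ∀ j, ∑ l ∈ Finset.range j, A l = a.psum j := fun j => (a.psum_eq_sum_range j).symm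
  have hsumB : ∀ j, ∑ l ∈ Finset.range j, B l = b.psum j := fun j => (b.psum_eq_sum_range j).symm
  have hb_le : ∀ j, b.psum j ≤ 1 := fun j => by
    rw [← b.psum_of_le (le_max_left n j)]
    exact monotone_nat_of_le_succ b.psum_mono (le_max_right n j)
  have haN : a.psum N = 1 := by
    rw [← a.psum_of_le (le_max_left m N), ← hsumA, ← hsumA]
    refine Finset.sum_subset (Finset.range_subset_range.2 (le_max_right _ _)) fun l _ hl => ?_
    exact hA_zero l (by simpa using hl)
  have hb_one : ∀ j, N ≤ j → b.psum j = 1 := fun j hj => le_antisymm (hb_le j) <| by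
    rw [← haN]
    exact (h N).trans (monotone_nat_of_le_succ b.psum_mono hj)
  have hB_zero : ∀ l, N ≤ l → B l = 0 := fun l hl => by
    simp only [hB]
    rw [hb_one l hl, hb_one _ (by omega), sub_self]
  set M := max (max m n) N with hM
  have htrunc : ∀ C : ℕ → ℝ, (∀ l, N ≤ l → C l = 0) →
      ∑ l ∈ Finset.range M, Real.negMulLog (C l)
        = ∑ l ∈ Finset.range N, Real.negMulLog (C l) := fun C hC => by
    refine (Finset.sum_subset (Finset.range_subset_range.2 (le_max_right _ _))
      fun l _ hl => ?_).symm
    rw [hC l (by simpa using hl), Real.negMulLog_zero]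
  rw [a.sum_comp_val Real.negMulLog_zero (m := M) (by omega),
    b.sum_comp_val Real.negMulLog_zero (m := M) (by omega), htrunc A hA_zero, htrunc B hB_zero]
  have h1 : ∑ l ∈ Finset.range N, Real.negMulLog (B l) ≤ ∑ l ∈ Finset.range N,
      (Real.negMulLog (A l) + (-Real.log (A l) - 1) * (B l - A l)) :=
    Finset.sum_le_sum fun l hl =>
      negMulLog_le_tangent (hA_pos l (Finset.mem_range.1 hl)) (hB_nonneg l)
  have h2 := sum_mul_le_of_partialSums_nonneg (fun l => -Real.log (A l) - 1)
    (fun l => B l - A l) N (fun j _ => by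
      rw [Finset.sum_sub_distrib, hsumA, hsumB]
      exact sub_nonneg.2 (h j)) (-Real.log (A (N - 1)) - 1)
    (fun l hl l' hl' => by
      have := Real.log_le_log (hA_pos l hl) (hA_anti hl')
      simpa using this)
    (fun l hl => by
      have := Real.log_le_log (hA_pos (N - 1) (by omega)) (hA_anti (show l ≤ N - 1 by omega))
      simpa using this)
  rw [Finset.sum_sub_distrib, hsumA, hsumB, haN, hb_one N le_rfl, sub_self, mul_zero] at h2
  rw [Finset.sum_add_distrib] at h1
  linarith

/-! ### Splitting the meet -/

/-- If all weights are at most `c` and `t` is at most `c` plus their sum, then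
some of them have a sum in the window `[t - c, t]`. -/
theorem exists_subset_sum_mem_window {ι : Type*} (A : Finset ι) (v : ι → ℝ) {c t : ℝ}
    (hv : ∀ l ∈ A, v l ≤ c) (ht : 0 ≤ t) (htc : t ≤ c + ∑ l ∈ A, v l) :
    ∃ A' ⊆ A, t - c ≤ ∑ l ∈ A', v l ∧ ∑ l ∈ A', v l ≤ t := by
  classical
  -- A largest subset with sum at most `t` cannot be enlarged, so its sum exceeds `t - c`.
  obtain ⟨A', hA', hmax⟩ := (A.powerset.filter fun B => ∑ l ∈ B, v l ≤ t).exists_max_image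
    Finset.card ⟨∅, by simpa using ht⟩
  simp only [Finset.mem_filter, Finset.mem_powerset] at hA' hmax
  refine ⟨A', hA'.1, ?_, hA'.2⟩
  by_cases hAA : A ⊆ A'
  · rw [← Finset.Subset.antisymm hAA hA'.1]
    linarith
  · obtain ⟨x, hxA, hxA'⟩ := Finset.not_subset.1 hAA
    by_contra! hlt
    have := hmax (insert x A') ⟨Finset.insert_subset hxA hA'.1, by
      rw [Finset.sum_insert hxA']
      linarith [hv x hxA]⟩
    rw [Finset.card_insert_of_notMem hxA'] at this
    omega

/-- If `q` is majorized by `p`, then `p` arises from `q` by cutting each `q l` into at most two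
parts: `q l - b l` goes to the component `l` of `p` and `b l` to the component `g l`. The part
that goes elsewhere is bounded by the slack of the majorization at `l`. -/
theorem OrderedProbVec.exists_two_part_splitting {n : ℕ} {p q : OrderedProbVec n} (hqp : q ≤ p) :
    ∃ (b : Fin n → ℝ) (g : Fin n → Fin n), (∀ l, 0 ≤ b l) ∧ (∀ l, b l ≤ q.val l) ∧
      (∀ l : Fin n, b l ≤ p.psum l - q.psum l) ∧
      ∀ m, p.val m = q.val m - b m + ∑ l with g l = m, b l := by
  classical
  -- Components are treated from the last to the first. After the components `≥ j` are treated,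
  have key : ∀ i ≤ n, ∀ j, j + i = n → ∃ (b : Fin n → ℝ) (g : Fin n → Option (Fin n)),
      (∀ l, 0 ≤ b l) ∧ (∀ l, b l ≤ q.val l) ∧ (∀ l : Fin n, b l ≤ p.psum l - q.psum l) ∧
      (∀ l : Fin n, l.val < j → b l = 0) ∧
      (∀ l m, g l = some m → j ≤ m.val) ∧
      (∑ l with g l = none, b l = p.psum j - q.psum j) ∧
      ∀ m : Fin n, j ≤ m.val → p.val m = q.val m - b m + ∑ l with g l = some m, b l := by
    intro i
    induction i with
    | zero =>
      intro _ j hj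
      have hj : j = n := by omega
      subst hj
      refine ⟨fun _ => 0, fun _ => none, by simp, q.nonneg, fun l => sub_nonneg.2 (hqp _),
        by simp, by simp, by simp [psum_of_le], fun m hm => absurd m.isLt (by omega)⟩
    | succ i ih =>
      intro hi j hj
      obtain ⟨b, g, hb0, hbq, hbs, hlow, hg, hqueue, hval⟩ := ih (by omega) (j + 1) (by omega)
      have hjn : j < n := by omega
      set J : Fin n := ⟨j, hjn⟩ with hJ
      have hbJ := hlow J (by simp [hJ])
      set A : Finset (Fin n) := (Finset.univ.filter fun l => g l = none).erase J with hA
      have hAsum : ∑ l ∈ A, b l = p.psum (j + 1) - q.psum (j + 1) := by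
        rw [← hqueue, Finset.sum_erase _ hbJ]
      have hps := p.psum_succ hjn
      have hqs := q.psum_succ hjn
      rw [← hJ] at hps hqs
      obtain ⟨A', hA'A, hA'1, hA'2⟩ := exists_subset_sum_mem_window A b (c := q.val J)
        (t := p.val J) (fun l _ => by
          by_cases hl : l.val < j + 1
          · rw [hlow l hl]
            exact q.nonneg J
          · exact (hbq l).trans (q.antitone (Fin.le_def.2 (by simp [hJ]; omega))))
        (p.nonneg J) (by linarith [hqp j])
      have hA'none : ∀ l ∈ A', g l = none := fun l hl => by
        have := hA'A hl
        simp only [hA, Finset.mem_erase, Finset.mem_filter] at this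
        exact this.2.2
      have hJA' : J ∉ A' := fun hh => by
        have := hA'A hh
        simp [hA] at this
      set b' : Fin n → ℝ := Function.update b J (q.val J - p.val J + ∑ l ∈ A', b l) with hb'
      have hb'J : b' J = q.val J - p.val J + ∑ l ∈ A', b l := by simp [hb']
      have hb'ne : ∀ l, l ≠ J → b' l = b l := fun l hl => by simp [hb', hl]
      -- `J` may already carry an assignment of its empty part; it is reset to `none`.
      set g' : Fin n → Option (Fin n) := fun l =>
        if l = J then none else if l ∈ A' then some J else g l with hg'
      have hb'0 : ∀ l, 0 ≤ b' l := fun l => by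
        by_cases hl : l = J
        · rw [hl, hb'J]
          linarith
        · rw [hb'ne l hl]
          exact hb0 l
      have hqueue' : ∑ l with g' l = none, b' l = p.psum j - q.psum j := by
        have hset : (Finset.univ.filter fun l => g' l = none) = insert J (A \ A') := by
          ext l
          by_cases hl : l = J
          · simp [hl, hg']
          · by_cases hl' : l ∈ A' <;> simp [hg', hA, hl, hl']
        rw [hset, Finset.sum_insert (by simp [hA]), hb'J,
          Finset.sum_congr rfl fun l hl => hb'ne l (fun h => by simp [h, hA] at hl)]
        have := Finset.sum_sdiff (f := b) hA'A
        linarith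
      refine ⟨b', g', hb'0, fun l => ?_, fun l => ?_, fun l hl => ?_, fun l m hlm => ?_, hqueue',
        fun m hm => ?_⟩
      · by_cases hl : l = J
        · rw [hl, hb'J]
          linarith
        · rw [hb'ne l hl]
          exact hbq l
      · by_cases hl : l = J
        · -- The new part joins the waiting ones, and these sum to the slack at `j`.
          rw [hl]
          change b' J ≤ p.psum j - q.psum j
          rw [← hqueue']
          exact Finset.single_le_sum (fun l _ => hb'0 l) (by simp [hg'])
        · rw [hb'ne l hl]
          exact hbs l
      · have hlJ : l ≠ J := fun h => by simp [h, hJ] at hl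
        rw [hb'ne l hlJ]
        exact hlow l (by omega)
      · by_cases hlJ : l = J
        · simp [hg', hlJ] at hlm
        by_cases hl' : l ∈ A'
        · simp only [hg', hlJ, hl', if_true, if_false, Option.some.injEq] at hlm
          simp [← hlm, hJ]
        · simp only [hg', hlJ, hl', if_false] at hlm
          have := hg l m hlm
          omega
      · by_cases hmJ : m = J
        · have hset : (Finset.univ.filter fun l => g' l = some J) = A' := by
            ext l
            by_cases hlJ : l = J
            · simp [hg', hlJ, hJA']
            by_cases hl' : l ∈ A'
            · simp [hg', hlJ, hl']
            · have : g l ≠ some J := fun h => by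
                have := hg l J h
                simp [hJ] at this
              simp [hg', hlJ, hl', this]
          rw [hmJ, hset, hb'J, Finset.sum_congr rfl fun l hl => hb'ne l fun h => hJA' (h ▸ hl)]
          ring
        · have hset : (Finset.univ.filter fun l => g' l = some m)
              = (Finset.univ.filter fun l => g l = some m).erase J := by
            ext l
            by_cases hlJ : l = J
            · simp [hg', hlJ]
            by_cases hl' : l ∈ A'
            · simp [hg', hlJ, hl', hA'none l hl', Ne.symm hmJ]
            · simp [hg', hlJ, hl']
          rw [hset, hb'ne m hmJ,
            Finset.sum_congr rfl fun l hl => hb'ne l (Finset.ne_of_mem_erase hl),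
            Finset.sum_erase _ hbJ]
          refine hval m ?_
          have : m.val ≠ j := fun h => hmJ (Fin.ext h)
          omega
  obtain ⟨b, g, hb0, hbq, hbs, -, -, hqueue, hval⟩ := key n le_rfl 0 (by omega)
  rw [psum_zero, psum_zero, sub_zero, Finset.sum_eq_zero_iff_of_nonneg fun l _ => hb0 l] at hqueue
  refine ⟨b, fun l => (g l).getD l, hb0, hbq, hbs, fun m => ?_⟩
  rw [hval m (Nat.zero_le _)]
  congr 1
  refine Finset.sum_subset (fun l hl => ?_) fun l hl hl' => ?_
  · simp only [Finset.mem_filter, Finset.mem_univ, true_and] at hl ⊢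
    simp [hl]
  · simp only [Finset.mem_filter, Finset.mem_univ, true_and] at hl hl'
    refine hqueue l ?_
    cases hgl : g l with
    | none => simp [hgl]
    | some m' =>
      rw [hgl] at hl hl'
      simp at hl hl'
      exact absurd hl hl'

/-- `k` cut points of a segment of length `c`, one of them its right end, cut it into at most `k`
pieces, and every initial segment up to a cut point is a union of pieces. -/
theorem exists_pieces_of_cuts {k : ℕ} {c : ℝ} (a : Fin k → ℝ) (h0 : ∀ i, 0 ≤ a i)
    (hc : ∀ i, a i ≤ c) (hex : ∃ i, a i = c) :
    ∃ (w : Fin k → ℝ) (S : Fin k → Finset (Fin k)), (∀ r, 0 ≤ w r) ∧ ∑ r, w r = c ∧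
      ∀ i, ∑ r ∈ S i, w r = a i := by
  set σ : Equiv.Perm (Fin k) := Tuple.sort a
  have hσ : Monotone fun r => a (σ r) := Tuple.monotone_sort a
  -- `s` lists `0` and the cut points in increasing order; the pieces are its increments.
  obtain ⟨s, hs0, hs1⟩ : ∃ s : ℕ → ℝ, s 0 = 0 ∧ ∀ r : Fin k, s (r.val + 1) = a (σ r) :=
    ⟨fun r => if h : r - 1 < k ∧ r ≠ 0 then a (σ ⟨r - 1, h.1⟩) else 0, by simp, fun r => by simp⟩
  have hsum : ∀ m : Fin k, ∑ r : Fin k with r ≤ m, (s (r.val + 1) - s r.val) = a (σ m) := fun m => by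
    rw [← hs1 m, ← sub_zero (s (m.val + 1)), ← hs0, ← Finset.sum_range_sub s (m.val + 1)]
    refine Finset.sum_bij (fun r _ => r.val) (fun r hr => ?_) (fun r _ r' _ h => Fin.ext h)
      (fun l hl => ?_) (fun _ _ => rfl)
    · have : r ≤ m := by simpa using hr
      simpa [Nat.lt_succ_iff] using this
    · have : l < m + 1 := by simpa using hl
      exact ⟨⟨l, this.trans_le m.isLt⟩,
        Finset.mem_filter.2 ⟨Finset.mem_univ _, Fin.le_def.2 (Nat.lt_succ_iff.1 this)⟩, rfl⟩
  have hw : ∀ r : Fin k, 0 ≤ s (r.val + 1) - s r.val := fun r => by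
    rw [hs1]
    by_cases hr : r.val = 0
    · rw [hr, hs0, sub_zero]
      exact h0 _
    · have h1 := hs1 ⟨r - 1, by omega⟩
      simp only [Nat.sub_add_cancel (Nat.one_le_iff_ne_zero.2 hr)] at h1
      rw [h1]
      exact sub_nonneg.2 (hσ (Fin.le_def.2 (by simp)))
  refine ⟨fun r => s (r.val + 1) - s r.val, fun i => Finset.univ.filter fun r => r ≤ σ.symm i, hw, ?_,
    fun i => by rw [hsum]; simp⟩
  obtain ⟨i, hi⟩ := hex
  refine le_antisymm ?_ ?_
  · have hk : k - 1 < k := by have := i.isLt; omega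
    have : (Finset.univ : Finset (Fin k))
        = Finset.univ.filter fun r => r ≤ (⟨k - 1, hk⟩ : Fin k) := by
      ext r
      simp [Fin.le_def]
      omega
    rw [this, hsum]
    exact hc _
  · rw [← hi, ← σ.apply_symm_apply i, ← hsum]
    exact Finset.sum_le_univ_sum_of_nonneg hw

/-- Finitely many ordered probability vectors have a common refinement in which every component
of their meet is cut into at most `k` pieces, `k` being the number of vectors. -/
theorem OrderedProbVec.exists_common_refinement {n k : ℕ} [NeZero k]
    (p : Fin k → OrderedProbVec n) :
    ∃ (w : Fin n → Fin k → ℝ) (F : Fin k → Fin n × Fin k → Fin n), (∀ l r, 0 ≤ w l r) ∧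
      (∀ l, ∑ r, w l r = (Finset.univ.inf' Finset.univ_nonempty p).val l) ∧
      ∀ i m, ∑ c with F i c = m, w c.1 c.2 = (p i).val m := by
  set q := Finset.univ.inf' Finset.univ_nonempty p
  choose b g hb0 hbq hbs hval using fun i =>
    exists_two_part_splitting (p := p i) (q := q) (Finset.inf'_le p (Finset.mem_univ i))
  -- The partial sum of the meet at `l` is attained by some `p i`, which does not cut `q.val l`.
  have hcut : ∀ l, ∃ i, q.val l - b i l = q.val l := fun l => by
    obtain ⟨i, -, hi⟩ := exists_psum_inf'_eq Finset.univ_nonempty p l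
    refine ⟨i, ?_⟩
    have h1 := hbs i l
    rw [← hi, sub_self] at h1
    linarith [hb0 i l]
  choose w S hw hwsum hS using fun l => exists_pieces_of_cuts (fun i => q.val l - b i l)
    (fun i => sub_nonneg.2 (hbq i l)) (fun i => by linarith [hb0 i l]) (hcut l)
  refine ⟨w, fun i c => if c.2 ∈ S c.1 i then c.1 else g i c.1, hw, hwsum, fun i m => ?_⟩
  have hrow : ∀ l, ∑ r, (if (if r ∈ S l i then l else g i l) = m then w l r else 0)
      = (if l = m then q.val l - b i l else 0) + if g i l = m then b i l else 0 := fun l => by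
    have h1 : ∑ r, (if r ∈ S l i then w l r else 0) = q.val l - b i l := by simp [hS]
    have h2 : ∑ r, (if r ∈ S l i then 0 else w l r) = b i l := by
      have : ∑ r, ((if r ∈ S l i then w l r else 0) + if r ∈ S l i then 0 else w l r)
          = q.val l := by
        rw [← hwsum l]
        exact Finset.sum_congr rfl fun r _ => by split_ifs <;> simp
      rw [Finset.sum_add_distrib, h1] at this
      linarith
    have h3 : ∀ r, (if (if r ∈ S l i then l else g i l) = m then w l r else 0)
        = (if l = m then (if r ∈ S l i then w l r else 0) else 0)
          + if g i l = m then (if r ∈ S l i then 0 else w l r) else 0 := fun r => by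
      split_ifs <;> simp_all
    rw [Finset.sum_congr rfl fun r _ => h3 r, Finset.sum_add_distrib]
    congr 1
    · split_ifs
      · exact h1
      · simp
    · split_ifs
      · exact h2
      · simp
  rw [Finset.sum_filter, Fintype.sum_prod_type]
  simp only
  rw [Finset.sum_congr rfl fun l _ => hrow l, Finset.sum_add_distrib, hval i m,
    Finset.sum_filter]
  simp

/-! ### Entropy of random variables -/

/-- A mass cut into `k` pieces gains at most `log k` per unit of entropy. -/
theorem sum_negMulLog_le_add_mul_log {k : ℕ} [NeZero k] (w : Fin k → ℝ) (hw : ∀ r, 0 ≤ w r) :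
    ∑ r, Real.negMulLog (w r)
      ≤ Real.negMulLog (∑ r, w r) + (∑ r, w r) * Real.log k := by
  have hk : (0 : ℝ) < k := by exact_mod_cast Nat.pos_of_ne_zero (NeZero.ne k)
  rcases (Finset.sum_nonneg fun r _ => hw r : 0 ≤ ∑ r, w r).eq_or_lt with h | h
  · have hz : ∀ r, w r = 0 := fun r =>
      (Finset.sum_eq_zero_iff_of_nonneg fun r _ => hw r).1 h.symm r (Finset.mem_univ r)
    simp [hz]
  · -- Each piece is compared with the mean piece, at which the tangent is taken.
    have h1 := Finset.sum_le_sum fun r (_ : r ∈ Finset.univ) =>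
      negMulLog_le_tangent (div_pos h hk) (hw r)
    refine h1.trans_eq ?_
    rw [Finset.sum_add_distrib, ← Finset.mul_sum, Finset.sum_sub_distrib]
    simp only [Finset.sum_const, Finset.card_univ, Fintype.card_fin, nsmul_eq_mul,
      Real.negMulLog, Real.log_div h.ne' hk.ne']
    field_simp
    ring

section Entropy

theorem mul_logb_one_div_eq (x : ℝ) :
    x * Real.logb 2 (1 / x) = Real.negMulLog x / Real.log 2 := by
  rw [one_div, Real.logb, Real.log_inv, Real.negMulLog]
  ring

theorem shannonEntropy_eq_ofReal_sum {α : Type*} [Fintype α] {p : α → ℝ} (h0 : ∀ a, 0 ≤ p a)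
    (h1 : ∀ a, p a ≤ 1) :
    shannonEntropy p = ENNReal.ofReal ((∑ a, Real.negMulLog (p a)) / Real.log 2) := by
  rw [shannonEntropy, tsum_fintype, Finset.sum_div, ENNReal.ofReal_sum_of_nonneg fun a _ =>
    div_nonneg (Real.negMulLog_nonneg (h0 a) (h1 a)) (Real.log_nonneg one_le_two)]
  exact Finset.sum_congr rfl fun a _ => by rw [mul_logb_one_div_eq]

theorem OrderedProbVec.val_le_one {n : ℕ} (a : OrderedProbVec n) (i : Fin n) : a.val i ≤ 1 := by
  rw [← a.sum_eq_one]
  exact Finset.single_le_sum (fun i _ => a.nonneg i) (Finset.mem_univ i)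

theorem OrderedProbVec.shannonEntropy_eq {n : ℕ} (a : OrderedProbVec n) :
    shannonEntropy a.val = ENNReal.ofReal ((∑ i, Real.negMulLog (a.val i)) / Real.log 2) :=
  shannonEntropy_eq_ofReal_sum a.nonneg a.val_le_one

variable {Ω : Type*} [MeasurableSpace Ω] {P : Measure Ω}

/-- The entropy of a function of `Z` is at most the entropy of `Z`. -/
theorem shannonEntropy_massFn_comp_le [IsProbabilityMeasure P] {𝒵 α : Type*} [Countable 𝒵]
    [MeasurableSpace 𝒵] [MeasurableSingletonClass 𝒵] {Z : Ω → 𝒵} (hZ : Measurable Z)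
    (h : 𝒵 → α) :
    shannonEntropy (massFn P fun ω => h (Z ω)) ≤ shannonEntropy (massFn P Z) := by
  unfold shannonEntropy
  rw [← (Equiv.sigmaFiberEquiv h).tsum_eq, ENNReal.tsum_sigma']
  refine ENNReal.tsum_le_tsum fun a => ?_
  set m := massFn P (fun ω => h (Z ω)) a with hm
  have hmass : ENNReal.ofReal m = ∑' z : {z // h z = a}, P (Z ⁻¹' {z.1}) := by
    rw [hm, massFn, ofReal_measureReal]
    exact (tsum_measure_preimage_singleton (s := {z | h z = a}) (Set.to_countable _)
      (f := Z) fun z _ => hZ (measurableSet_singleton z)).symm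
  rw [ENNReal.ofReal_mul (p := m) measureReal_nonneg, hmass, ← ENNReal.tsum_mul_right]
  refine ENNReal.tsum_le_tsum fun z => ?_
  change _ ≤ ENNReal.ofReal (massFn P Z z.1 * Real.logb 2 (1 / massFn P Z z.1))
  rw [ENNReal.ofReal_mul (p := massFn P Z z.1) measureReal_nonneg, massFn, ofReal_measureReal]
  -- Atoms of `Z` of mass zero are split off: there `log (1 / 0) = 0` breaks the monotonicity.
  rcases eq_or_ne (P (Z ⁻¹' {z.1})) 0 with h0 | h0
  · simp [h0]
  · have hpos : 0 < P.real (Z ⁻¹' {z.1}) := ENNReal.toReal_pos h0 (measure_ne_top _ _)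
    have hle : P.real (Z ⁻¹' {z.1}) ≤ m := measureReal_mono fun ω hω => by
      have : Z ω = z.1 := hω
      simp [this, z.2]
    gcongr
    · exact one_lt_two
    · exact one_div_pos.2 (hpos.trans_le hle)

/-- Two random variables concentrated on a countable set have the same distribution if their
probability mass functions agree there. -/
theorem identDistrib_of_measure_preimage_singleton_eq {Ω' γ : Type*} [MeasurableSpace Ω']
    {P' : Measure Ω'} [MeasurableSpace γ] [MeasurableSingletonClass γ] {U : Ω → γ} {V : Ω' → γ}
    (hU : Measurable U) (hV : Measurable V) {C : Set γ} (hC : C.Countable)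
    (hUC : ∀ᵐ ω ∂P, U ω ∈ C) (hVC : ∀ᵐ ω ∂P', V ω ∈ C)
    (h : ∀ c ∈ C, P (U ⁻¹' {c}) = P' (V ⁻¹' {c})) : IdentDistrib U V P P' := by
  refine ⟨hU.aemeasurable, hV.aemeasurable, Measure.ext fun B hB => ?_⟩
  rw [Measure.map_apply hU hB, Measure.map_apply hV hB]
  have h1 : P (U ⁻¹' B) = P (U ⁻¹' (B ∩ C)) := measure_congr <| by
    filter_upwards [hUC] with ω hω
    exact propext ⟨fun hB => ⟨hB, hω⟩, fun hB => hB.1⟩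
  have h2 : P' (V ⁻¹' B) = P' (V ⁻¹' (B ∩ C)) := measure_congr <| by
    filter_upwards [hVC] with ω hω
    exact propext ⟨fun hB => ⟨hB, hω⟩, fun hB => hB.1⟩
  have hBC : (B ∩ C).Countable := hC.mono Set.inter_subset_right
  rw [h1, h2, ← tsum_measure_preimage_singleton hBC fun y _ => hU (measurableSet_singleton y),
    ← tsum_measure_preimage_singleton hBC fun y _ => hV (measurableSet_singleton y)]
  exact tsum_congr fun c => h c.1 c.2.2

end Entropy

/-! ### Functional representations -/

section Representation

variable {Ω 𝒳 𝒴 : Type*} [MeasurableSpace Ω] [MeasurableSpace 𝒳] [MeasurableSingletonClass 𝒳]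
  {P : Measure Ω} {X : Ω → 𝒳} {Y : Ω → 𝒴}

theorem measure_preimage_inter_eq_mul_cond [IsFiniteMeasure P] (hX : Measurable X) (x : 𝒳)
    (y : 𝒴) :
    P (X ⁻¹' {x} ∩ Y ⁻¹' {y}) = P (X ⁻¹' {x}) * P[|X ⁻¹' {x}] (Y ⁻¹' {y}) := by
  rw [mul_comm, cond_mul_eq_inter (hX (measurableSet_singleton x))]

variable [MeasurableSpace 𝒴] [MeasurableSingletonClass 𝒴]

/-- In a functional representation, `f x Z` has the conditional distribution of `Y` given
`X = x`. -/
theorem IsFunctionalRepresentation.massFn_eq [IsProbabilityMeasure P] {Ω' 𝒵 : Type*}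
    [MeasurableSpace Ω'] [MeasurableSpace 𝒵] [DiscreteMeasurableSpace 𝒵] {P' : Measure Ω'}
    {X' : Ω' → 𝒳} {Z : Ω' → 𝒵} {f : 𝒳 → 𝒵 → 𝒴}
    (hR : IsFunctionalRepresentation P X Y P' X' Z f) (hX : Measurable X) (x : 𝒳)
    (hx : P (X ⁻¹' {x}) ≠ 0) (y : 𝒴) :
    massFn P[|X ⁻¹' {x}] Y y = massFn P' (fun ω => f x (Z ω)) y := by
  have h1 := hR.identDistrib.measure_mem_eq (measurableSet_singleton (x, y))
  have h2 := (hR.identDistrib.comp measurable_fst).measure_mem_eq (measurableSet_singleton x)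
  have h3 := hR.indep.measure_inter_preimage_eq_mul {x} (f x ⁻¹' {y}) (measurableSet_singleton x)
    (MeasurableSet.of_discrete)
  have e1 : (fun ω => (X ω, Y ω)) ⁻¹' {(x, y)} = X ⁻¹' {x} ∩ Y ⁻¹' {y} := by
    ext ω
    simp
  have e2 : (fun ω => (X' ω, f (X' ω) (Z ω))) ⁻¹' {(x, y)} = X' ⁻¹' {x} ∩ Z ⁻¹' (f x ⁻¹' {y}) := by
    ext ω
    simp +contextual
  change P (X ⁻¹' {x}) = P' (X' ⁻¹' {x}) at h2
  rw [e1, e2, h3, measure_preimage_inter_eq_mul_cond hX x, ← h2] at h1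
  rw [ENNReal.mul_right_inj hx (measure_ne_top _ _)] at h1
  rw [massFn, massFn, measureReal_def, h1, measureReal_def]
  rfl

end Representation

/-- The entropy of a functional representation is at least the entropy of the meet of the
conditional distributions. -/
theorem shannonEntropy_inf'_le_of_isFunctionalRepresentation
    {Ω 𝒳 𝒴 Ω' 𝒵 : Type*} [MeasurableSpace Ω] (P : Measure Ω) [IsProbabilityMeasure P]
    [MeasurableSpace 𝒳] [MeasurableSingletonClass 𝒳] [Fintype 𝒴] [MeasurableSpace 𝒴]
    [MeasurableSingletonClass 𝒴] (X : Ω → 𝒳) (hX : Measurable X) (Y : Ω → 𝒴) (hY : Measurable Y)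
    {k : ℕ} [NeZero k] (x : Fin k → 𝒳) (hx : ∀ i, P (X ⁻¹' {x i}) ≠ 0)
    [MeasurableSpace Ω'] (P' : Measure Ω') [IsProbabilityMeasure P'] [Countable 𝒵]
    [MeasurableSpace 𝒵] [MeasurableSingletonClass 𝒵] (X' : Ω' → 𝒳) (Z : Ω' → 𝒵) (f : 𝒳 → 𝒵 → 𝒴)
    (hR : IsFunctionalRepresentation P X Y P' X' Z f) :
    shannonEntropy (Finset.univ.inf' Finset.univ_nonempty fun i =>
        OrderedProbVec.ofDist (condDist P X hY (x i) (hx i))).val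
      ≤ shannonEntropy (massFn P' Z) := by
  classical
  have hZ := hR.measurable_right
  -- `Z` may be replaced by the finitely many values that `f` makes of it.
  set W : Ω' → Fin k → 𝒴 := fun ω i => f (x i) (Z ω) with hW
  have hWm : Measurable W := measurable_pi_lambda _ fun i => (Measurable.of_discrete).comp hZ
  refine le_trans ?_ (shannonEntropy_massFn_comp_le hZ fun z i => f (x i) z)
  have hsum : ∀ s : Finset (Fin k → 𝒴), ∑ a ∈ s, massFn P' W a = P'.real (W ⁻¹' s) := fun s =>
    sum_measureReal_preimage_singleton s fun a _ => hWm (measurableSet_singleton a)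
  set w : stdSimplex ℝ (Fin k → 𝒴) := ⟨massFn P' W, fun _ => measureReal_nonneg, by
    rw [hsum]
    simp⟩ with hw
  have hmaj : ∀ j, (OrderedProbVec.ofDist w).psum j ≤
      (Finset.univ.inf' Finset.univ_nonempty fun i =>
        OrderedProbVec.ofDist (condDist P X hY (x i) (hx i))).psum j := fun j => by
    obtain ⟨i, -, hi⟩ := OrderedProbVec.exists_psum_inf'_eq Finset.univ_nonempty
      (fun i => OrderedProbVec.ofDist (condDist P X hY (x i) (hx i))) j
    rw [hi]
    refine OrderedProbVec.psum_ofDist_le_of_map w _ (fun a => a i) (fun y => ?_) j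
    change massFn P[|X ⁻¹' {x i}] Y y = ∑ a with a i = y, massFn P' W a
    rw [hR.massFn_eq hX (x i) (hx i), hsum, massFn]
    congr 1
    ext ω
    simp [hW]
  have hent : shannonEntropy (massFn P' W)
      = ENNReal.ofReal ((∑ i, Real.negMulLog ((OrderedProbVec.ofDist w).val i))
        / Real.log 2) := by
    rw [shannonEntropy_eq_ofReal_sum (p := massFn P' W) (fun _ => measureReal_nonneg)
      fun _ => measureReal_le_one]
    congr 2
    exact (Fintype.sum_equiv (OrderedProbVec.sortEquiv w) _ _ fun _ => rfl).symm
  refine le_of_le_of_eq ?_ hent.symm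
  rw [OrderedProbVec.shannonEntropy_eq]
  have := OrderedProbVec.sum_negMulLog_le _ _ hmaj
  have := Real.log_nonneg one_le_two
  gcongr

/-- On an extension of the probability space there is a functional representation whose entropy
exceeds that of the meet of the conditional distributions by at most `log k`. -/
theorem exists_isFunctionalRepresentation_shannonEntropy_le
    {Ω : Type u} {𝒳 𝒴 : Type*} [MeasurableSpace Ω] (P : Measure Ω) [IsProbabilityMeasure P]
    [MeasurableSpace 𝒳] [MeasurableSingletonClass 𝒳] [Fintype 𝒴] [MeasurableSpace 𝒴]
    [MeasurableSingletonClass 𝒴] (X : Ω → 𝒳) (hX : Measurable X) (Y : Ω → 𝒴) (hY : Measurable Y)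
    {k : ℕ} [NeZero k] (x : Fin k → 𝒳) (hx_inj : Function.Injective x)
    (hx : ∀ i, P (X ⁻¹' {x i}) ≠ 0) (hx_val : ∀ᵐ ω ∂P, X ω ∈ Set.range x) :
    ∃ (Ω' : Type u) (_ : MeasurableSpace Ω') (P' : Measure Ω') (_ : IsProbabilityMeasure P')
      (π : Ω' → Ω) (_ : MeasurePreserving π P' P) (Z : Ω' → ℕ) (f : 𝒳 → ℕ → 𝒴),
      IsFunctionalRepresentation P X Y P' (X ∘ π) Z f ∧
      shannonEntropy (massFn P' Z)
        ≤ shannonEntropy (Finset.univ.inf' Finset.univ_nonempty fun i =>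
            OrderedProbVec.ofDist (condDist P X hY (x i) (hx i))).val
          + ENNReal.ofReal (Real.logb 2 k) := by
  classical
  set p := fun i => OrderedProbVec.ofDist (condDist P X hY (x i) (hx i)) with hp
  obtain ⟨w, F, hw0, hwq, hF⟩ := OrderedProbVec.exists_common_refinement p
  set q := Finset.univ.inf' Finset.univ_nonempty p with hq
  have hw1 : ∑ c : Fin (Fintype.card 𝒴) × Fin k, w c.1 c.2 = 1 := by
    rw [Fintype.sum_prod_type, ← q.sum_eq_one]
    exact Finset.sum_congr rfl fun l _ => hwq l
  obtain ⟨ω₀⟩ : Nonempty Ω := nonempty_of_isProbabilityMeasure P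
  have : Nonempty 𝒴 := ⟨Y ω₀⟩
  have : Nonempty (Fin (Fintype.card 𝒴) × Fin k) :=
    ⟨(⟨0, Fintype.card_pos⟩, ⟨0, Nat.pos_of_ne_zero (NeZero.ne k)⟩)⟩
  set ν : PMF (Fin (Fintype.card 𝒴) × Fin k) :=
    PMF.ofFintype (fun c => ENNReal.ofReal (w c.1 c.2)) (by
      rw [← ENNReal.ofReal_sum_of_nonneg fun c _ => hw0 _ _, hw1, ENNReal.ofReal_one]) with hν
  have hν_apply : ∀ s : Finset (Fin (Fintype.card 𝒴) × Fin k),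
      ν.toMeasure s = ENNReal.ofReal (∑ c ∈ s, w c.1 c.2) := fun s => by
    rw [PMF.toMeasure_apply_finset, ENNReal.ofReal_sum_of_nonneg fun c _ => hw0 _ _]
    rfl
  set enc : Fin (Fintype.card 𝒴) × Fin k → ℕ := fun c => (Fintype.equivFin _ c).val with henc
  have henc_inj : Function.Injective enc := Fin.val_injective.comp (Equiv.injective _)
  -- Off `range x`, a null set for `X`, the value of `f` is arbitrary.
  set f : 𝒳 → ℕ → 𝒴 := fun t z => if h : ∃ i, x i = t then
    OrderedProbVec.sortEquiv (condDist P X hY (x h.choose) (hx h.choose))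
      (F h.choose (Function.invFun enc z)) else Y ω₀ with hf
  have hf_apply : ∀ i c, f (x i) (enc c)
      = OrderedProbVec.sortEquiv (condDist P X hY (x i) (hx i)) (F i c) := fun i c => by
    have h : ∃ i', x i' = x i := ⟨i, rfl⟩
    have hi : h.choose = i := hx_inj h.choose_spec
    simp only [hf, h, dif_pos, Function.leftInverse_invFun henc_inj c]
    rw [hi]
  have hf_meas : ∀ z, Measurable fun t => f t z := fun z B hB => by
    -- `f · z` is constant off the finite set `range x`.
    have hfin : ∀ D : Set 𝒳, D ⊆ Set.range x → MeasurableSet D := fun D hD =>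
      ((Set.finite_range x).subset hD).measurableSet
    have hsplit : (fun t => f t z) ⁻¹' B = ((fun t => f t z) ⁻¹' B ∩ Set.range x)
        ∪ ((fun t => f t z) ⁻¹' B ∩ (Set.range x)ᶜ) := (Set.inter_union_compl _ _).symm
    have hoff : ∀ t ∉ Set.range x, f t z = Y ω₀ := fun t ht => dif_neg ht
    rw [hsplit]
    refine (hfin _ Set.inter_subset_right).union ?_
    by_cases hB' : Y ω₀ ∈ B
    · have : (fun t => f t z) ⁻¹' B ∩ (Set.range x)ᶜ = (Set.range x)ᶜ :=
        Set.inter_eq_right.2 fun t ht => by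
          change f t z ∈ B
          rwa [hoff t ht]
      rw [this]
      exact (hfin _ subset_rfl).compl
    · have : (fun t => f t z) ⁻¹' B ∩ (Set.range x)ᶜ = ∅ :=
        Set.eq_empty_of_forall_notMem fun t ht => hB' (by
          have h1 : f t z ∈ B := ht.1
          rwa [hoff t ht.2] at h1)
      rw [this]
      exact MeasurableSet.empty
  have hf_meas' : Measurable fun tz : 𝒳 × ℕ => f tz.1 tz.2 :=
    measurable_from_prod_countable_left hf_meas
  set P' := P.prod ν.toMeasure with hP'
  set Z : Ω × (Fin (Fintype.card 𝒴) × Fin k) → ℕ := fun ω => enc ω.2 with hZ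
  have henc_meas : Measurable enc := .of_discrete
  have hZm : Measurable Z := henc_meas.comp measurable_snd
  have hXm : Measurable (X ∘ (Prod.fst : Ω × (Fin (Fintype.card 𝒴) × Fin k) → Ω)) :=
    hX.comp measurable_fst
  refine ⟨Ω × (Fin (Fintype.card 𝒴) × Fin k), inferInstance, P', inferInstance, Prod.fst,
    measurePreserving_fst, Z, f, ⟨hXm, hZm, indepFun_prod hX henc_meas, ?_⟩, ?_⟩
  · refine identDistrib_of_measure_preimage_singleton_eq (C := Set.range x ×ˢ Set.univ)
      (hX.prodMk hY) (hXm.prodMk (hf_meas'.comp (hXm.prodMk hZm)))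
      ((Set.countable_range x).prod Set.countable_univ) ?_ ?_ ?_
    · filter_upwards [hx_val] with ω hω using ⟨hω, trivial⟩
    · have := (measurePreserving_fst (μ := P) (ν := ν.toMeasure)).quasiMeasurePreserving.ae hx_val
      filter_upwards [this] with ω hω using ⟨hω, trivial⟩
    · rintro ⟨-, y⟩ ⟨⟨i, rfl⟩, -⟩
      set e := OrderedProbVec.sortEquiv (condDist P X hY (x i) (hx i)) with he
      have e1 : (fun ω => (X ω, Y ω)) ⁻¹' {(x i, y)} = X ⁻¹' {x i} ∩ Y ⁻¹' {y} := by
        ext ω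
        simp
      have e2 : (fun ω : Ω × (Fin (Fintype.card 𝒴) × Fin k) =>
            ((X ∘ Prod.fst) ω, f ((X ∘ Prod.fst) ω) (Z ω))) ⁻¹' {(x i, y)}
          = (X ⁻¹' {x i}) ×ˢ
            ((Finset.univ.filter fun c => F i c = e.symm y : Finset _) : Set _) := by
        ext ω
        simp only [Set.mem_preimage, Set.mem_singleton_iff, Prod.mk.injEq, Set.mem_prod,
          Finset.coe_filter, Finset.mem_univ, true_and, Set.mem_ofPred_eq, Function.comp_apply]
        refine and_congr_right fun h => ?_
        rw [h, hZ, hf_apply, Equiv.eq_symm_apply]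
      have hpe : (p i).val (e.symm y) = massFn P[|X ⁻¹' {x i}] Y y := by
        rw [hp, OrderedProbVec.ofDist_val, ← he, Equiv.apply_symm_apply]
        rfl
      rw [e1, e2, measure_preimage_inter_eq_mul_cond hX (x i), hP', Measure.prod_prod,
        hν_apply, hF, hpe, massFn]
      have := cond_isProbabilityMeasure (hx i)
      rw [ofReal_measureReal]
  · refine (shannonEntropy_massFn_comp_le (P := P') measurable_snd enc).trans ?_
    have hmass : massFn P' (Prod.snd : Ω × (Fin (Fintype.card 𝒴) × Fin k) → _)
        = fun c => w c.1 c.2 := by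
      ext c
      have h1 : (Prod.snd : Ω × (Fin (Fintype.card 𝒴) × Fin k) → _) ⁻¹' {c}
          = Set.univ ×ˢ ((({c} : Finset _)) : Set _) := by
        ext ω
        simp
      rw [massFn, h1, measureReal_def, hP', Measure.prod_prod, measure_univ, one_mul, hν_apply,
        Finset.sum_singleton, ENNReal.toReal_ofReal (hw0 _ _)]
    have hlog : 0 < Real.log 2 := Real.log_pos one_lt_two
    rw [hmass, shannonEntropy_eq_ofReal_sum
        (p := fun c : Fin (Fintype.card 𝒴) × Fin k => w c.1 c.2) (fun c => hw0 c.1 c.2) fun c => by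
        rw [← hw1]
        exact Finset.single_le_sum (f := fun c : Fin (Fintype.card 𝒴) × Fin k => w c.1 c.2)
          (fun c _ => hw0 c.1 c.2) (Finset.mem_univ c),
      q.shannonEntropy_eq, ← ENNReal.ofReal_add (div_nonneg (Finset.sum_nonneg fun l _ =>
        Real.negMulLog_nonneg (q.nonneg l) (q.val_le_one l)) hlog.le)
        (Real.logb_nonneg one_lt_two
          (by exact_mod_cast Nat.one_le_iff_ne_zero.2 (NeZero.ne k))), Real.logb, ← add_div]
    refine ENNReal.ofReal_le_ofReal (div_le_div_of_nonneg_right ?_ hlog.le)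
    rw [Fintype.sum_prod_type]
    calc ∑ l, ∑ r, Real.negMulLog (w l r)
        ≤ ∑ l, (Real.negMulLog (q.val l) + q.val l * Real.log k) :=
          Finset.sum_le_sum fun l _ => by
            rw [← hwq l]
            exact sum_negMulLog_le_add_mul_log (w l) (hw0 l)
      _ = ∑ l, Real.negMulLog (q.val l) + Real.log k := by
          rw [Finset.sum_add_distrib, ← Finset.sum_mul, q.sum_eq_one, one_mul]

theorem corollary2
    {Ω : Type u} [MeasurableSpace Ω] (P : Measure Ω) [IsProbabilityMeasure P]
    {𝒳 : Type*} [MeasurableSpace 𝒳] [MeasurableSingletonClass 𝒳]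
    {𝒴 : Type*} [Fintype 𝒴] [MeasurableSpace 𝒴] [MeasurableSingletonClass 𝒴]
    (X : Ω → 𝒳) (hX : Measurable X) (Y : Ω → 𝒴) (hY : Measurable Y)
    {k : ℕ} [NeZero k] (x : Fin k → 𝒳) (hx_inj : Function.Injective x)
    (hx_pos : ∀ i, P (X ⁻¹' {x i}) ≠ 0) (hx_val : ∀ᵐ ω ∂P, X ω ∈ Set.range x)
    (p : Fin k → OrderedProbVec (Fintype.card 𝒴))
    (hp : ∀ i, p i = OrderedProbVec.ofDist (condDist P X hY (x i) (hx_pos i))) :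
    (∀ {Ω' : Type*} [MeasurableSpace Ω'] (P' : Measure Ω') [IsProbabilityMeasure P']
        {𝒵 : Type*} [Countable 𝒵] [MeasurableSpace 𝒵] [MeasurableSingletonClass 𝒵]
        (X' : Ω' → 𝒳) (Z : Ω' → 𝒵) (f : 𝒳 → 𝒵 → 𝒴),
        IsFunctionalRepresentation P X Y P' X' Z f →
        shannonEntropy (Finset.univ.inf' Finset.univ_nonempty p).val
          ≤ shannonEntropy (massFn P' Z)) ∧
    (∃ (Ω' : Type u) (_ : MeasurableSpace Ω') (P' : Measure Ω') (_ : IsProbabilityMeasure P')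
        (π : Ω' → Ω) (_ : MeasurePreserving π P' P) (Z : Ω' → ℕ) (f : 𝒳 → ℕ → 𝒴),
        IsFunctionalRepresentation P X Y P' (X ∘ π) Z f ∧
        shannonEntropy (massFn P' Z)
          ≤ shannonEntropy (Finset.univ.inf' Finset.univ_nonempty p).val
            + ENNReal.ofReal (Real.logb 2 k)) := by
  obtain rfl : p = fun i => OrderedProbVec.ofDist (condDist P X hY (x i) (hx_pos i)) := funext hp
  exact ⟨fun P' _ _ _ _ _ X' Z f hR =>
      shannonEntropy_inf'_le_of_isFunctionalRepresentation P X hX Y hY x hx_pos P' X' Z f hR,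
    exists_isFunctionalRepresentation_shannonEntropy_le P X hX Y hY x hx_inj hx_pos hx_val⟩
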